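/- Let $m,n$ be positive integers, let $x\in\mathbb{R}^n$, and let $a_1,\dots,a_m\in\mathbb{R}^n$ be independent random vectors with law $\mathcal N(0,I_n)$. Put $\psi_i=|\langle a_i,x\rangle|$, $\hat r=\sqrt{\frac1m\sum_{i=1}^m\psi_i^2}$, $\mathcal I^-=\{i:\psi_i^2\le \hat r^2/2\}$ and $\mathcal I^+=\{i:\psi_i^2\ge \hat r^2/2\}$. Given coefficients $\lambda^-<0<\lambda^+$, let $\hat d$ be a maximizer, over all $z\in\mathbb{R}^n$ with $\|z\|_2=1$, of $$z^{\top}\Big(\frac{\lambda^-}{|\mathcal I^-|}\sum_{i\in\mathcal I^-}a_ia_i^{\top}+\frac{\lambda^+}{|\mathcal I^+|}\sum_{i\in\mathcal I^+}a_ia_i^{\top}\Big)z ,$$ and put $z_0=\hat r\,\hat d$. Write $\mathrm{dist}(z,x)=\min\{\|z+x\|_2,\|z-x\|_2\}$. Then for every $\delta_0\in(0,1)$ there are constants $c_0>0$ and $C_0$, depending only on $\delta_0$ (not on $m$, $n$, $x$, $\lambda^-$, $\lambda^+$), such that whenever $m\ge C_0n$, with probability at least $1-10e^{-c_0m}$ both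 index sets are non-empty (so that the matrix above is well defined) and $$\mathrm{dist}(z_0,x)\le\delta_0\|x\|_2$$ for every choice of the maximizer $\hat d$. -/

import Mathlib

open MeasureTheory ProbabilityTheory
open scoped Matrix

noncomputable section

namespace PhaseRetrieval

variable {m n : ℕ}

/-- The observed magnitudes `ψ i = |⟨a i, x⟩|`. -/
def magnitude (a : Fin m → EuclideanSpace ℝ (Fin n)) (x : EuclideanSpace ℝ (Fin n))
    (i : Fin m) : ℝ :=
  |inner ℝ (a i) x|

/-- The norm estimate `√((1/m) ∑ i, ψ i ^ 2)`. -/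
def normEst (ψ : Fin m → ℝ) : ℝ :=
  Real.sqrt ((1 / (m : ℝ)) * ∑ i, ψ i ^ 2)

/-- The samples of low magnitude. -/
def lowSet (ψ : Fin m → ℝ) : Finset (Fin m) :=
  Finset.univ.filter fun i => ψ i ^ 2 ≤ normEst ψ ^ 2 / 2

/-- The samples of high magnitude. -/
def highSet (ψ : Fin m → ℝ) : Finset (Fin m) :=
  Finset.univ.filter fun i => normEst ψ ^ 2 / 2 ≤ ψ i ^ 2

/-- The outer product `v vᵀ`. -/
def outer (v : EuclideanSpace ℝ (Fin n)) : Matrix (Fin n) (Fin n) ℝ :=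
  Matrix.of fun j k => v j * v k

/-- The weighted matrix
`(lamNeg / |I⁻|) ∑_{i ∈ I⁻} a i (a i)ᵀ + (lamPos / |I⁺|) ∑_{i ∈ I⁺} a i (a i)ᵀ`. -/
def initMatrix (lamNeg lamPos : ℝ) (a : Fin m → EuclideanSpace ℝ (Fin n)) (ψ : Fin m → ℝ) :
    Matrix (Fin n) (Fin n) ℝ :=
  (lamNeg / ((lowSet ψ).card : ℝ)) • ∑ i ∈ lowSet ψ, outer (a i) +
    (lamPos / ((highSet ψ).card : ℝ)) • ∑ i ∈ highSet ψ, outer (a i)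

/-- The quadratic form `zᵀ M z`. -/
def quadForm (M : Matrix (Fin n) (Fin n) ℝ) (z : EuclideanSpace ℝ (Fin n)) : ℝ :=
  (fun j => z j) ⬝ᵥ (M *ᵥ fun j => z j)

/-- `d` maximizes `zᵀ M z` over the Euclidean unit sphere. -/
def IsTopDirection (M : Matrix (Fin n) (Fin n) ℝ) (d : EuclideanSpace ℝ (Fin n)) : Prop :=
  ‖d‖ = 1 ∧ ∀ z : EuclideanSpace ℝ (Fin n), ‖z‖ = 1 → quadForm M z ≤ quadForm M d

/-- The distance from `z` to the solution set `{x, -x}`. -/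
def signDist (z x : EuclideanSpace ℝ (Fin n)) : ℝ :=
  min ‖z + x‖ ‖z - x‖

/-- The initialization is well defined (no division by `|I⁻| = 0` or `|I⁺| = 0`) and, whichever
maximizer is selected, the resulting initial point is within `δ₀ ‖x‖` of the solution set. -/
def GoodInit (lamNeg lamPos δ₀ : ℝ) (a : Fin m → EuclideanSpace ℝ (Fin n))
    (x : EuclideanSpace ℝ (Fin n)) : Prop :=
  (lowSet (magnitude a x)).Nonempty ∧ (highSet (magnitude a x)).Nonempty ∧
    ∀ d : EuclideanSpace ℝ (Fin n),
      IsTopDirection (initMatrix lamNeg lamPos a (magnitude a x)) d →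
        signDist (normEst (magnitude a x) • d) x ≤ δ₀ * ‖x‖

end PhaseRetrieval

end

/-!
Write `u = x / ‖x‖`, let `g i = ⟨a i, u⟩`, and normalize `‖x‖ = 1`. For a weight `h : ℝ → [0, 1]` the
weighted empirical second moment `(1/m) ∑ i, h (g i) ⟨a i, z⟩ ^ 2` (`empForm`) has expectation
`q ⟨u, z⟩ ^ 2 + p (1 - ⟨u, z⟩ ^ 2)` at a unit vector `z`, where `p = E h(g)` and `q = E h(g) g ^ 2`
(`integral_weight_mul_inner_sq`): the component of `a i` orthogonal to `u` is independent of `g i`.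
A Chernoff bound for sub-exponential variables at each point of a net of at most `5 ^ n` points of
the sphere shows that the empirical form is uniformly close to its mean, with exponentially small
failure probability once `m` exceeds a multiple of `n`
(`measureReal_exists_empForm_sub_meanForm_le`).

The index sets of the initialization are defined through `r̂`, which couples the samples. But `r̂ ^ 2`
is close to `1`, so the indicators of `g i ^ 2 ≤ r̂ ^ 2 / 2` and `g i ^ 2 ≤ 1 / 2` differ only where
`g i ^ 2` lies in a narrow band around `1 / 2`, and the weighted second moment of that band is
itself uniformly small (`abs_sum_sub_meanForm_le`). Hence four deterministic weights suffice: the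
constant `1`, low, high, and the band.

For the low weight `p - q = κ`, and for the high weight, its complement, `p - q = -κ`, with the same
`κ > 0` (`spike`). So if a unit vector `d` is not nearly parallel to `u`, replacing `d` by `u`
strictly decreases the low sum and strictly increases the high sum. Both changes increase the
objective, whatever the coefficients `λ⁻ < 0 < λ⁺` and the sizes of the (non-empty) index sets, which
is why the constants depend on `δ₀` alone (`goodInit_of_concentrated`).
-/

namespace PhaseRetrieval

/-! ### One-dimensional marginals of the standard Gaussian -/

lemma integrable_sq_gaussianReal : Integrable (fun g : ℝ => g ^ 2) (gaussianReal 0 1) :=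
  (memLp_id_gaussianReal 2).integrable_sq

lemma integral_sq_gaussianReal : ∫ g, g ^ 2 ∂gaussianReal 0 1 = 1 := by
  have h := variance_fun_id_gaussianReal (μ := 0) (v := 1)
  rw [variance_eq_integral (by fun_prop)] at h
  simpa using h

lemma integrable_exp_sq_gaussianReal :
    Integrable (fun g : ℝ => Real.exp (g ^ 2 / 4)) (gaussianReal 0 1) := by
  rw [gaussianReal_of_var_ne_zero _ one_ne_zero,
    integrable_withDensity_iff (measurable_gaussianPDF 0 1)
      (Filter.Eventually.of_forall fun x => gaussianPDF_lt_top)]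
  have h := (integrable_exp_neg_mul_sq (b := 1 / 4) (by norm_num)).mul_const
    ((√(2 * Real.pi * 1))⁻¹)
  refine h.congr (Filter.Eventually.of_forall fun x => ?_)
  simp only [toReal_gaussianPDF, gaussianPDFReal, NNReal.coe_one, sub_zero]
  rw [show -(1 / 4) * x ^ 2 = x ^ 2 / 4 + -x ^ 2 / (2 * 1) by ring, Real.exp_add]
  ring

variable {n : ℕ}

lemma hasGaussianLaw_inner_pair (u w : EuclideanSpace ℝ (Fin n)) :
    HasGaussianLaw (fun a : EuclideanSpace ℝ (Fin n) => (inner ℝ a u, inner ℝ a w))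
      (stdGaussian (EuclideanSpace ℝ (Fin n))) := by
  have h := (IsGaussian.hasGaussianLaw_id
    (μ := stdGaussian (EuclideanSpace ℝ (Fin n)))).map_fun
      ((innerSL ℝ u).prod (innerSL ℝ w))
  simpa [real_inner_comm] using h

lemma covariance_inner_stdGaussian (u w : EuclideanSpace ℝ (Fin n)) :
    cov[fun a => inner ℝ a u, fun a => inner ℝ a w;
      stdGaussian (EuclideanSpace ℝ (Fin n))] = inner ℝ u w := by
  have h := covarianceBilin_apply_eq_cov
    (μ := stdGaussian (EuclideanSpace ℝ (Fin n))) IsGaussian.memLp_two_id u w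
  rw [covarianceBilin_stdGaussian] at h
  simp_rw [real_inner_comm _ u, real_inner_comm _ w] at h
  exact h.symm

lemma integral_inner_stdGaussian (w : EuclideanSpace ℝ (Fin n)) :
    ∫ a, inner ℝ a w ∂stdGaussian (EuclideanSpace ℝ (Fin n)) = 0 := by
  have h := integral_strongDual_stdGaussian (E := EuclideanSpace ℝ (Fin n)) (innerSL ℝ w)
  simpa [real_inner_comm] using h

lemma variance_inner_stdGaussian (w : EuclideanSpace ℝ (Fin n)) :
    Var[fun a => inner ℝ a w; stdGaussian (EuclideanSpace ℝ (Fin n))] = ‖w‖ ^ 2 := by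
  rw [← covariance_self (by fun_prop), covariance_inner_stdGaussian, real_inner_self_eq_norm_sq]

lemma integral_inner_sq_stdGaussian (w : EuclideanSpace ℝ (Fin n)) :
    ∫ a, (inner ℝ a w : ℝ) ^ 2 ∂stdGaussian (EuclideanSpace ℝ (Fin n)) = ‖w‖ ^ 2 := by
  have h := variance_inner_stdGaussian w
  rw [variance_eq_integral (by fun_prop), integral_inner_stdGaussian] at h
  simpa using h

lemma hasLaw_inner_stdGaussian {z : EuclideanSpace ℝ (Fin n)} (hz : ‖z‖ = 1) :
    HasLaw (fun a => inner ℝ a z) (gaussianReal 0 1)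
      (stdGaussian (EuclideanSpace ℝ (Fin n))) where
  aemeasurable := by fun_prop
  map_eq := by
    rw [(hasGaussianLaw_inner_pair z z).fst.map_eq_gaussianReal, integral_inner_stdGaussian,
      variance_inner_stdGaussian, hz]
    simp

lemma indepFun_inner_stdGaussian {u w : EuclideanSpace ℝ (Fin n)} (h : inner ℝ u w = 0) :
    IndepFun (fun a => (inner ℝ a u : ℝ)) (fun a => (inner ℝ a w : ℝ))
      (stdGaussian (EuclideanSpace ℝ (Fin n))) :=
  (hasGaussianLaw_inner_pair u w).indepFun_of_covariance_eq_zero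
    ((covariance_inner_stdGaussian u w).trans h)

lemma memLp_inner_stdGaussian (w : EuclideanSpace ℝ (Fin n)) :
    MemLp (fun a => (inner ℝ a w : ℝ)) 2 (stdGaussian (EuclideanSpace ℝ (Fin n))) :=
  (hasGaussianLaw_inner_pair w w).fst.memLp_two

/-- The second moment in direction `z` of a Gaussian vector weighted by a function of its
component along `u`: the weight only reshapes the moment along `u`. -/
lemma integral_weight_mul_inner_sq {h : ℝ → ℝ} (hm : Measurable h)
    (h0 : ∀ t, 0 ≤ h t) (h1 : ∀ t, h t ≤ 1) {u z : EuclideanSpace ℝ (Fin n)}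
    (hu : ‖u‖ = 1) (hz : ‖z‖ = 1) :
    ∫ a, h (inner ℝ a u) * (inner ℝ a z : ℝ) ^ 2 ∂stdGaussian (EuclideanSpace ℝ (Fin n)) =
      (∫ g, h g * g ^ 2 ∂gaussianReal 0 1) * (inner ℝ u z : ℝ) ^ 2 +
        (∫ g, h g ∂gaussianReal 0 1) * (1 - (inner ℝ u z : ℝ) ^ 2) := by
  set c : ℝ := inner ℝ u z with hc
  set w := z - c • u with hw
  have huu : (inner ℝ u u : ℝ) = 1 := by rw [real_inner_self_eq_norm_sq, hu]; norm_num
  have huw : (inner ℝ u w : ℝ) = 0 := by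
    rw [hw, inner_sub_right, real_inner_smul_right, huu, ← hc]; ring
  have hww : ‖w‖ ^ 2 = 1 - c ^ 2 := by
    rw [hw, norm_sub_sq_real, real_inner_smul_right, real_inner_comm, ← hc, norm_smul, hz, hu,
      Real.norm_eq_abs, mul_one, sq_abs]
    ring
  have hind := indepFun_inner_stdGaussian huw
  have hb : ∀ t, ‖h t‖ ≤ 1 := fun t => by
    rw [Real.norm_eq_abs, abs_of_nonneg (h0 t)]; exact h1 t
  have hmu : Measurable fun a : EuclideanSpace ℝ (Fin n) => h (inner ℝ a u) :=
    hm.comp (by fun_prop)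
  have e1 : ∫ a, h (inner ℝ a u) * (inner ℝ a u : ℝ) ^ 2
      ∂stdGaussian (EuclideanSpace ℝ (Fin n)) = ∫ g, h g * g ^ 2 ∂gaussianReal 0 1 :=
    (hasLaw_inner_stdGaussian hu).integral_comp (f := fun g => h g * g ^ 2)
      (by fun_prop)
  have e2 : ∫ a, (h (inner ℝ a u) * (inner ℝ a u : ℝ)) * (inner ℝ a w : ℝ)
      ∂stdGaussian (EuclideanSpace ℝ (Fin n)) = 0 := by
    have := (hind.comp (φ := fun g => h g * g) (ψ := id) (by fun_prop)
      measurable_id).integral_fun_mul_eq_mul_integral (by fun_prop) (by fun_prop)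
    simp only [Function.comp_apply, id] at this
    rw [this, integral_inner_stdGaussian, mul_zero]
  have e3 : ∫ a, h (inner ℝ a u) * (inner ℝ a w : ℝ) ^ 2
      ∂stdGaussian (EuclideanSpace ℝ (Fin n)) = (∫ g, h g ∂gaussianReal 0 1) * (1 - c ^ 2) := by
    have := (hind.comp (φ := h) (ψ := fun g => g ^ 2) hm
      (by fun_prop)).integral_fun_mul_eq_mul_integral hmu.aestronglyMeasurable (by fun_prop)
    simp only [Function.comp_apply] at this
    rw [this, integral_inner_sq_stdGaussian, hww]
    congr 1
    exact (hasLaw_inner_stdGaussian hu).integral_comp (f := h) (by fun_prop)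
  have i1 : Integrable (fun a => h (inner ℝ a u) * (inner ℝ a u : ℝ) ^ 2)
      (stdGaussian (EuclideanSpace ℝ (Fin n))) :=
    (memLp_inner_stdGaussian u).integrable_sq.bdd_mul hmu.aestronglyMeasurable
      (Filter.Eventually.of_forall fun a => hb _)
  have i2 : Integrable (fun a => (h (inner ℝ a u) * (inner ℝ a u : ℝ)) * (inner ℝ a w : ℝ))
      (stdGaussian (EuclideanSpace ℝ (Fin n))) := by
    simp_rw [mul_assoc]
    exact ((memLp_inner_stdGaussian u).integrable_mul (memLp_inner_stdGaussian w)).bdd_mul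
      hmu.aestronglyMeasurable (Filter.Eventually.of_forall fun a => hb _)
  have i3 : Integrable (fun a => h (inner ℝ a u) * (inner ℝ a w : ℝ) ^ 2)
      (stdGaussian (EuclideanSpace ℝ (Fin n))) :=
    (memLp_inner_stdGaussian w).integrable_sq.bdd_mul hmu.aestronglyMeasurable
      (Filter.Eventually.of_forall fun a => hb _)
  calc _ = ∫ a, (c ^ 2 * (h (inner ℝ a u) * (inner ℝ a u : ℝ) ^ 2) +
        2 * c * ((h (inner ℝ a u) * (inner ℝ a u : ℝ)) * (inner ℝ a w : ℝ))) +
        h (inner ℝ a u) * (inner ℝ a w : ℝ) ^ 2 ∂stdGaussian (EuclideanSpace ℝ (Fin n)) := by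
        refine integral_congr_ae (Filter.Eventually.of_forall fun a => ?_)
        have : (inner ℝ a z : ℝ) = c * inner ℝ a u + inner ℝ a w := by
          rw [hw, inner_sub_right, real_inner_smul_right]; ring
        simp only [this]
        ring
    _ = _ := by
        have i12 : Integrable (fun a => c ^ 2 * (h (inner ℝ a u) * (inner ℝ a u : ℝ) ^ 2) +
            2 * c * ((h (inner ℝ a u) * (inner ℝ a u : ℝ)) * (inner ℝ a w : ℝ)))
            (stdGaussian (EuclideanSpace ℝ (Fin n))) := (i1.const_mul _).add (i2.const_mul _)
        rw [integral_add i12 i3,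
          integral_add (i1.const_mul _) (i2.const_mul _), integral_const_mul, integral_const_mul,
          e1, e2, e3]
        ring

end PhaseRetrieval

namespace PhaseRetrieval

/-! ### A Chernoff bound for sub-exponential sums -/

lemma exp_le_one_add_add_sq {s x : ℝ} (hs : |s| ≤ 1 / 8) :
    Real.exp (s * x) ≤ 1 + s * x + 128 * s ^ 2 * Real.exp (|x| / 4) := by
  have h1 : Real.exp (s * x) ≤ 1 + s * x + (s * x) ^ 2 * Real.exp |s * x| := by
    have h := Complex.norm_exp_sub_sum_le_norm_mul_exp ((s * x : ℝ) : ℂ) 2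
    have e : Complex.exp ((s * x : ℝ) : ℂ) -
        ∑ k ∈ Finset.range 2, ((s * x : ℝ) : ℂ) ^ k / (k.factorial : ℂ) =
          ((Real.exp (s * x) - (1 + s * x) : ℝ) : ℂ) := by
      simp [Finset.sum_range_succ]
    rw [e, Complex.norm_real, Complex.norm_real, Real.norm_eq_abs, Real.norm_eq_abs, sq_abs] at h
    linarith [le_abs_self (Real.exp (s * x) - (1 + s * x))]
  have h2 : Real.exp |s * x| ≤ Real.exp (|x| / 8) := by
    rw [abs_mul]
    gcongr
    nlinarith [abs_nonneg x]
  have h3 : x ^ 2 ≤ 128 * Real.exp (|x| / 8) := by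
    have := Real.quadratic_le_exp_of_nonneg (x := |x| / 8) (by positivity)
    nlinarith [abs_nonneg x, sq_abs x]
  have h4 : Real.exp (|x| / 4) = Real.exp (|x| / 8) * Real.exp (|x| / 8) := by
    rw [← Real.exp_add]; ring_nf
  calc _ ≤ _ := h1
    _ ≤ 1 + s * x + (s ^ 2 * (128 * Real.exp (|x| / 8))) * Real.exp (|x| / 8) := by
      rw [mul_pow]; gcongr
    _ = _ := by rw [h4]; ring

/-- Centred variables dominated by `G ^ 2 + 1`, with `G` standard Gaussian, have a
moment generating function with Gaussian-type growth near the origin, uniformly in the variable. -/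
lemma mgf_le_of_abs_le_sq {𝓧 : Type*} [MeasurableSpace 𝓧] {ν : Measure 𝓧}
    [IsProbabilityMeasure ν] {G f : 𝓧 → ℝ} (hG : HasLaw G (gaussianReal 0 1) ν)
    (hf : Measurable f) (hfG : ∀ a, |f a| ≤ G a ^ 2 + 1) (h0 : ∫ a, f a ∂ν = 0)
    {s : ℝ} (hs : |s| ≤ 1 / 8) :
    Integrable (fun a => Real.exp (s * f a)) ν ∧
      ∫ a, Real.exp (s * f a) ∂ν ≤ Real.exp
        (128 * (Real.exp (1 / 4) * ∫ g, Real.exp (g ^ 2 / 4) ∂gaussianReal 0 1) * s ^ 2) := by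
  have hGi : Integrable (fun a => Real.exp (G a ^ 2 / 4)) ν := by
    have := integrable_exp_sq_gaussianReal
    rw [← hG.map_eq] at this
    exact this.comp_aemeasurable hG.aemeasurable
  have hGe : ∫ a, Real.exp (G a ^ 2 / 4) ∂ν = ∫ g, Real.exp (g ^ 2 / 4) ∂gaussianReal 0 1 :=
    hG.integral_comp (f := fun g => Real.exp (g ^ 2 / 4)) (by fun_prop)
  have hdom : ∀ a, Real.exp (|f a| / 4) ≤ Real.exp (1 / 4) * Real.exp (G a ^ 2 / 4) := fun a => by
    rw [← Real.exp_add]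
    gcongr
    linarith [hfG a]
  have hi : Integrable (fun a => Real.exp (s * f a)) ν := by
    refine (hGi.const_mul (Real.exp (1 / 4))).mono' (by fun_prop)
      (Filter.Eventually.of_forall fun a => ?_)
    rw [Real.norm_eq_abs, Real.abs_exp]
    refine le_trans ?_ (hdom a)
    gcongr
    calc s * f a ≤ |s| * |f a| := by rw [← abs_mul]; exact le_abs_self _
      _ ≤ |f a| / 4 := by nlinarith [abs_nonneg (f a)]
  have hfi : Integrable f ν := by
    refine (hGi.const_mul (4 * Real.exp (1 / 4))).mono' (by fun_prop)
      (Filter.Eventually.of_forall fun a => ?_)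
    rw [Real.norm_eq_abs]
    nlinarith [hdom a, Real.add_one_le_exp (|f a| / 4)]
  refine ⟨hi, ?_⟩
  have hR : Integrable (fun a => 128 * s ^ 2 * (Real.exp (1 / 4) * Real.exp (G a ^ 2 / 4))) ν :=
    (hGi.const_mul _).const_mul _
  calc ∫ a, Real.exp (s * f a) ∂ν
      ≤ ∫ a, ((1 + s * f a) +
          128 * s ^ 2 * (Real.exp (1 / 4) * Real.exp (G a ^ 2 / 4))) ∂ν := by
        refine integral_mono hi (((integrable_const _).add (hfi.const_mul s)).add hR) fun a => ?_
        refine (exp_le_one_add_add_sq hs).trans ?_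
        gcongr
        exact hdom a
    _ = 128 * (Real.exp (1 / 4) * ∫ g, Real.exp (g ^ 2 / 4) ∂gaussianReal 0 1) * s ^ 2 + 1 := by
        have h1f : Integrable (fun a => 1 + s * f a) ν := (integrable_const _).add (hfi.const_mul s)
        rw [integral_add h1f hR,
          integral_add (integrable_const _) (hfi.const_mul s), integral_const_mul,
          integral_const_mul, integral_const_mul, h0, hGe]
        simp
        ring
    _ ≤ _ := Real.add_one_le_exp _

/-- The Chernoff bound with parameter `s`, where `K s ≤ ε / 2` makes the linear gain absorb the
quadratic term. -/
lemma measureReal_sum_ge_le {Ω : Type*} [MeasurableSpace Ω] {P : Measure Ω}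
    [IsProbabilityMeasure P] {m : ℕ} {X : Fin m → Ω → ℝ} (hX : iIndepFun X P)
    (hm : ∀ i, AEMeasurable (X i) P) {K s ε : ℝ} (hs : 0 ≤ s)
    (hi : ∀ i, Integrable (fun ω => Real.exp (s * X i ω)) P)
    (hK : ∀ i, mgf (X i) P s ≤ Real.exp (K * s ^ 2)) (hle : K * s ≤ ε / 2) :
    P.real {ω | ε * m ≤ ∑ i, X i ω} ≤ Real.exp (-(s * ε / 2 * m)) := by
  have hprod := hX.mgf_sum₀ (t := s) hm Finset.univ
  have hle' : mgf (∑ i, X i) P s ≤ Real.exp (K * s ^ 2 * m) := by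
    rw [hprod]
    calc ∏ i, mgf (X i) P s ≤ ∏ _i : Fin m, Real.exp (K * s ^ 2) :=
          Finset.prod_le_prod (fun i _ => mgf_nonneg) fun i _ => hK i
      _ = _ := by rw [Finset.prod_const, ← Real.exp_nat_mul]; simp [mul_comm]
  -- `mgf` is zero where the exponential is not integrable, whereas the product is positive
  have hint : Integrable (fun ω => Real.exp (s * (∑ i, X i) ω)) P := by
    by_contra hcon
    have h0 : mgf (∑ i, X i) P s = 0 := mgf_undef hcon
    rw [hprod, Finset.prod_eq_zero_iff] at h0
    obtain ⟨i, -, h0⟩ := h0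
    exact (mgf_pos (hi i)).ne' h0
  have h := measure_ge_le_exp_mul_mgf (ε * m) hs hint
  simp only [Finset.sum_apply] at h
  refine h.trans ?_
  calc _ ≤ Real.exp (-s * (ε * m)) * Real.exp (K * s ^ 2 * m) := by gcongr
    _ ≤ _ := by
      rw [← Real.exp_add]
      gcongr
      have : (K * s) * (s * m) ≤ ε / 2 * (s * m) := by gcongr
      nlinarith

/-- A rate of decay for the deviations of sums of independent variables whose moment generating
functions are at most `exp (K s ^ 2)` for `|s| ≤ 1 / 8`: the first factor is the value of `s` used in
Chernoff's inequality. -/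
noncomputable def chernoffRate (K ε : ℝ) : ℝ := min (1 / 8) (ε / (2 * K)) * ε / 2

lemma chernoffRate_pos {K ε : ℝ} (hK : 0 < K) (hε : 0 < ε) : 0 < chernoffRate K ε := by
  unfold chernoffRate
  positivity

lemma measureReal_abs_sum_ge_le {Ω : Type*} [MeasurableSpace Ω] {P : Measure Ω}
    [IsProbabilityMeasure P] {m : ℕ} {X : Fin m → Ω → ℝ} (hX : iIndepFun X P)
    (hm : ∀ i, AEMeasurable (X i) P) {K ε : ℝ} (hKpos : 0 < K) (hε : 0 < ε)
    (h : ∀ i, ∀ s : ℝ, |s| ≤ 1 / 8 → Integrable (fun ω => Real.exp (s * X i ω)) P ∧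
      ∫ ω, Real.exp (s * X i ω) ∂P ≤ Real.exp (K * s ^ 2)) :
    P.real {ω | ε * m ≤ |∑ i, X i ω|} ≤ 2 * Real.exp (-(chernoffRate K ε * m)) := by
  set s := min (1 / 8) (ε / (2 * K)) with hsdef
  have hs0 : 0 ≤ s := by positivity
  have hs8 : |s| ≤ 1 / 8 := by rw [abs_of_nonneg hs0]; exact min_le_left _ _
  have hsK : K * s ≤ ε / 2 := by
    calc K * s ≤ K * (ε / (2 * K)) := by gcongr; exact min_le_right _ _
      _ = ε / 2 := by field_simp
  have hpos := measureReal_sum_ge_le hX hm hs0 (fun i => (h i s hs8).1)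
    (fun i => (h i s hs8).2) hsK
  have hX' : iIndepFun (fun i ω => -X i ω) P := hX.comp (fun _ x => -x) fun _ => measurable_neg
  have hneg := measureReal_sum_ge_le (X := fun i ω => -X i ω) (K := K) (ε := ε) hX'
    (fun i => (hm i).neg) hs0
    (fun i => by
      have := (h i (-s) (by rwa [abs_neg])).1
      simpa using this)
    (fun i => by
      have := (h i (-s) (by rwa [abs_neg])).2
      simpa [mgf] using this) hsK
  calc _ ≤ P.real ({ω | ε * m ≤ ∑ i, X i ω} ∪ {ω | ε * m ≤ ∑ i, -X i ω}) := by
        refine measureReal_mono fun ω hω => ?_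
        simp only [Set.mem_ofPred_eq, Set.mem_union, Finset.sum_neg_distrib] at hω ⊢
        exact le_abs.1 hω
    _ ≤ _ := (measureReal_union_le _ _).trans (by
        simp only [chernoffRate]
        rw [← hsdef]
        linarith)

end PhaseRetrieval

namespace PhaseRetrieval

/-! ### Quadratic forms on a net of the sphere -/

variable {n : ℕ}

/-- A `1/2`-net of the unit sphere with at most `5 ^ n` points. Otherwise every `1/2`-separated subset
of the sphere could be enlarged, against the volume bound on separated sets. -/
lemma exists_sphere_net (n : ℕ) : ∃ s : Finset (EuclideanSpace ℝ (Fin n)),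
    s.card ≤ 5 ^ n ∧ (∀ w ∈ s, ‖w‖ = 1) ∧ ∀ z, ‖z‖ = 1 → ∃ w ∈ s, ‖z - w‖ ≤ 1 / 2 := by
  classical
  by_contra! hcon
  have hcard : ∀ s : Finset (EuclideanSpace ℝ (Fin n)), (∀ w ∈ s, ‖w‖ = 1) →
      (∀ w ∈ s, ∀ w' ∈ s, w ≠ w' → 1 / 2 ≤ ‖w - w'‖) → s.card ≤ 5 ^ n := fun s h1 h2 => by
    have hinj : Function.Injective fun w : EuclideanSpace ℝ (Fin n) => (2 : ℝ) • w :=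
      smul_right_injective _ two_ne_zero
    have h := Besicovitch.card_le_of_separated (s.image fun w => (2 : ℝ) • w)
      (by
        simp only [Finset.mem_image, forall_exists_index, and_imp, forall_apply_eq_imp_iff₂]
        intro w hw
        rw [norm_smul, h1 w hw]; norm_num)
      (by
        simp only [Finset.mem_image, forall_exists_index, and_imp, forall_apply_eq_imp_iff₂]
        intro w hw w' hw' hne
        rw [← smul_sub, norm_smul, Real.norm_eq_abs, abs_two]
        linarith [h2 w hw w' hw' fun h => hne (by rw [h])])
    rwa [Finset.card_image_of_injective _ hinj, finrank_euclideanSpace_fin] at h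
  have hall : ∀ k : ℕ, ∃ s : Finset (EuclideanSpace ℝ (Fin n)), s.card = k ∧
      (∀ w ∈ s, ‖w‖ = 1) ∧ ∀ w ∈ s, ∀ w' ∈ s, w ≠ w' → 1 / 2 ≤ ‖w - w'‖ := by
    intro k
    induction k with
    | zero => exact ⟨∅, by simp⟩
    | succ k ih =>
      obtain ⟨s, hk, h1, h2⟩ := ih
      obtain ⟨z, hz, hzs⟩ := hcon s (hcard s h1 h2) h1
      have hnot : z ∉ s := fun h => by
        have := hzs z h
        rw [sub_self, norm_zero] at this
        linarith
      refine ⟨insert z s, by rw [Finset.card_insert_of_notMem hnot, hk], ?_, ?_⟩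
      · intro w hw
        rcases Finset.mem_insert.1 hw with rfl | hw
        exacts [hz, h1 w hw]
      · intro w hw w' hw' hne
        rcases Finset.mem_insert.1 hw with hwz | hws <;>
          rcases Finset.mem_insert.1 hw' with hwz' | hws'
        · exact absurd (hwz.trans hwz'.symm) hne
        · rw [hwz]; exact (hzs w' hws').le
        · rw [hwz', norm_sub_rev]; exact (hzs w hws).le
        · exact h2 w hws w' hws' hne
  obtain ⟨s, hk, h1, h2⟩ := hall (5 ^ n + 1)
  have := hcard s h1 h2
  omega

/-- Polarization: a quadratic form bounded by `M` on the unit sphere is Lipschitz there. Keeping the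
factor `‖z + w‖`, which is below `2` for distinct unit vectors, is what makes a `1/2`-net fine
enough in `abs_apply_le_of_net`. -/
lemma abs_apply_sub_apply_le {B : LinearMap.BilinForm ℝ (EuclideanSpace ℝ (Fin n))}
    (hB : ∀ z w, B z w = B w z) {M : ℝ} (hM : ∀ z, ‖z‖ = 1 → |B z z| ≤ M)
    {z w : EuclideanSpace ℝ (Fin n)} (hz : ‖z‖ = 1) :
    |B z z - B w w| ≤ M * (‖z - w‖ * ‖z + w‖) := by
  have hM0 : 0 ≤ M := (abs_nonneg _).trans (hM z hz)
  have hM' : ∀ y, |B y y| ≤ M * ‖y‖ ^ 2 := fun y => by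
    rcases eq_or_ne y 0 with rfl | hy
    · simp
    have hy' : ‖y‖ ≠ 0 := norm_ne_zero_iff.2 hy
    have h := hM (‖y‖⁻¹ • y) (by rw [norm_smul, norm_inv, norm_norm, inv_mul_cancel₀ hy'])
    simp only [map_smul, LinearMap.smul_apply, smul_eq_mul] at h
    rw [← mul_assoc, abs_mul, abs_of_nonneg (by positivity : (0 : ℝ) ≤ ‖y‖⁻¹ * ‖y‖⁻¹)] at h
    calc |B y y| = (‖y‖⁻¹ * ‖y‖⁻¹ * |B y y|) * ‖y‖ ^ 2 := by field_simp
      _ ≤ _ := by gcongr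
  set p := z - w with hp
  set q := z + w with hq
  have hsub : B z z - B w w = B p q := by
    simp only [hp, hq, map_add, map_sub, LinearMap.sub_apply, hB w z]
    ring
  rw [hsub]
  rcases eq_or_ne p 0 with h0 | h0
  · simp [h0]
  rcases eq_or_ne q 0 with h0' | h0'
  · simp [h0']
  have hp0 : 0 < ‖p‖ := norm_pos_iff.2 h0
  have hq0 : 0 < ‖q‖ := norm_pos_iff.2 h0'
  -- `‖q‖ • p` and `‖p‖ • q` have the common norm `‖p‖ * ‖q‖`, for which polarization is sharp
  have e : 4 * (‖p‖ * ‖q‖) * B p q =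
      B (‖q‖ • p + ‖p‖ • q) (‖q‖ • p + ‖p‖ • q) - B (‖q‖ • p - ‖p‖ • q) (‖q‖ • p - ‖p‖ • q) := by
    simp only [map_add, map_sub, map_smul, LinearMap.sub_apply, LinearMap.add_apply,
      LinearMap.smul_apply, smul_eq_mul, hB q p]
    ring
  have hpar : ‖‖q‖ • p + ‖p‖ • q‖ ^ 2 + ‖‖q‖ • p - ‖p‖ • q‖ ^ 2 = 4 * (‖p‖ * ‖q‖) ^ 2 := by
    have := parallelogram_law_with_norm ℝ (‖q‖ • p) (‖p‖ • q)
    simp only [norm_smul, norm_norm] at this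
    nlinarith
  have hpq : 4 * (‖p‖ * ‖q‖) * |B p q| ≤ 4 * (‖p‖ * ‖q‖) * (M * (‖p‖ * ‖q‖)) := by
    calc 4 * (‖p‖ * ‖q‖) * |B p q| = |4 * (‖p‖ * ‖q‖) * B p q| := by
          rw [abs_mul, abs_of_pos (by positivity : (0 : ℝ) < 4 * (‖p‖ * ‖q‖))]
      _ ≤ M * ‖‖q‖ • p + ‖p‖ • q‖ ^ 2 + M * ‖‖q‖ • p - ‖p‖ • q‖ ^ 2 := by
          rw [e]
          exact (abs_sub _ _).trans (add_le_add (hM' _) (hM' _))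
      _ = _ := by rw [← mul_add, hpar]; ring
  exact le_of_mul_le_mul_left hpq (by positivity)

/-- A quadratic form small on a `1/2`-net of the sphere is small on the sphere. The constant is
`1 / (1 - r)` rounded up, where `r = √15 / 4 < 31 / 32` is the contraction at distance `1/2`. -/
lemma abs_apply_le_of_net {B : LinearMap.BilinForm ℝ (EuclideanSpace ℝ (Fin n))}
    (hB : ∀ z w, B z w = B w z) (hcont : Continuous fun z => B z z)
    {s : Finset (EuclideanSpace ℝ (Fin n))} (h1 : ∀ w ∈ s, ‖w‖ = 1)
    (hs : ∀ z, ‖z‖ = 1 → ∃ w ∈ s, ‖z - w‖ ≤ 1 / 2) {ε : ℝ} (hε : ∀ w ∈ s, |B w w| ≤ ε)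
    {z : EuclideanSpace ℝ (Fin n)} (hz : ‖z‖ = 1) : |B z z| ≤ 32 * ε := by
  obtain ⟨y, hy, hmax⟩ := (isCompact_sphere (0 : EuclideanSpace ℝ (Fin n)) 1).exists_isMaxOn
    ⟨z, by simpa using hz⟩ hcont.abs.continuousOn
  have hy1 : ‖y‖ = 1 := by simpa using hy
  have hM : ∀ z, ‖z‖ = 1 → |B z z| ≤ |B y y| := fun z hz => hmax (by simpa using hz)
  refine (hM z hz).trans ?_
  obtain ⟨w, hw, hyw⟩ := hs y hy1
  have hlip := abs_apply_sub_apply_le hB hM hy1 (w := w)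
  have hpar := parallelogram_law_with_norm ℝ y w
  rw [hy1, h1 w hw] at hpar
  have hr : ‖y - w‖ * ‖y + w‖ ≤ 31 / 32 := by
    refine abs_le_of_sq_le_sq' ?_ (by norm_num) |>.2
    have h4 : ‖y - w‖ ^ 2 ≤ 1 / 4 := by nlinarith [norm_nonneg (y - w)]
    nlinarith [sq_nonneg ‖y - w‖]
  have := abs_sub_abs_le_abs_sub (B y y) (B w w)
  nlinarith [hε w hw, abs_nonneg (B y y)]

end PhaseRetrieval

namespace PhaseRetrieval

/-! ### Uniform concentration of weighted empirical second moments -/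

variable {m n : ℕ}

/-- The weighted empirical second moment `(1/m) ∑ i, h ⟨a i, u⟩ ⟨a i, z⟩ ^ 2`. -/
noncomputable def empForm (h : ℝ → ℝ) (a : Fin m → EuclideanSpace ℝ (Fin n))
    (u z : EuclideanSpace ℝ (Fin n)) : ℝ :=
  (1 / (m : ℝ)) * ∑ i, h (inner ℝ (a i) u) * (inner ℝ (a i) z : ℝ) ^ 2

/-- The mean `E h(g)` of a weight, for `g` standard Gaussian. -/
noncomputable def gaussMass (h : ℝ → ℝ) : ℝ := ∫ g, h g ∂gaussianReal 0 1

/-- The weighted second moment `E h(g) g ^ 2`, for `g` standard Gaussian. -/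
noncomputable def gaussMoment (h : ℝ → ℝ) : ℝ := ∫ g, h g * g ^ 2 ∂gaussianReal 0 1

/-- The expectation of `empForm h a u z` for standard Gaussian `a i` and unit vectors `u`, `z`. -/
noncomputable def meanForm (h : ℝ → ℝ) (u z : EuclideanSpace ℝ (Fin n)) : ℝ :=
  gaussMoment h * (inner ℝ u z : ℝ) ^ 2 + gaussMass h * (1 - (inner ℝ u z : ℝ) ^ 2)

/-- The centred form `empForm - meanForm`, as a bilinear form. -/
noncomputable def centredForm (h : ℝ → ℝ) (a : Fin m → EuclideanSpace ℝ (Fin n))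
    (u : EuclideanSpace ℝ (Fin n)) : LinearMap.BilinForm ℝ (EuclideanSpace ℝ (Fin n)) :=
  (1 / (m : ℝ)) • ∑ i, h (inner ℝ (a i) u) •
      (innerₗ _ (a i)).smulRight (innerₗ _ (a i)) -
    (gaussMoment h - gaussMass h) • (innerₗ _ u).smulRight (innerₗ _ u) -
    gaussMass h • innerₗ _

lemma centredForm_apply (h : ℝ → ℝ) (a : Fin m → EuclideanSpace ℝ (Fin n))
    (u z w : EuclideanSpace ℝ (Fin n)) : centredForm h a u z w =
      (1 / (m : ℝ)) * ∑ i, h (inner ℝ (a i) u) * ((inner ℝ (a i) z : ℝ) * inner ℝ (a i) w) -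
        (gaussMoment h - gaussMass h) * ((inner ℝ u z : ℝ) * inner ℝ u w) -
        gaussMass h * inner ℝ z w := by
  simp [centredForm, LinearMap.sum_apply]

lemma centredForm_self (h : ℝ → ℝ) (a : Fin m → EuclideanSpace ℝ (Fin n))
    (u : EuclideanSpace ℝ (Fin n)) {z : EuclideanSpace ℝ (Fin n)} (hz : ‖z‖ = 1) :
    centredForm h a u z z = empForm h a u z - meanForm h u z := by
  rw [centredForm_apply, real_inner_self_eq_norm_sq, hz, empForm, meanForm]
  simp only [← pow_two]
  ring

lemma continuous_centredForm_self (h : ℝ → ℝ) (a : Fin m → EuclideanSpace ℝ (Fin n))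
    (u : EuclideanSpace ℝ (Fin n)) : Continuous fun z => centredForm h a u z z := by
  simp only [centredForm_apply]
  fun_prop

lemma gaussMass_nonneg {h : ℝ → ℝ} (h0 : ∀ t, 0 ≤ h t) : 0 ≤ gaussMass h :=
  integral_nonneg h0

lemma integrable_weight {h : ℝ → ℝ} (hm : Measurable h) (h0 : ∀ t, 0 ≤ h t) (h1 : ∀ t, h t ≤ 1) :
    Integrable h (gaussianReal 0 1) :=
  Integrable.of_bound hm.aestronglyMeasurable 1 (Filter.Eventually.of_forall fun t => by
    rw [Real.norm_eq_abs, abs_of_nonneg (h0 t)]; exact h1 t)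

lemma integrable_weight_mul_sq {h : ℝ → ℝ} (hm : Measurable h) (h0 : ∀ t, 0 ≤ h t)
    (h1 : ∀ t, h t ≤ 1) : Integrable (fun g => h g * g ^ 2) (gaussianReal 0 1) :=
  integrable_sq_gaussianReal.bdd_mul hm.aestronglyMeasurable
    (Filter.Eventually.of_forall fun t => by
      rw [Real.norm_eq_abs, abs_of_nonneg (h0 t)]; exact h1 t)

/-- The constant `K` for which the centred summands of `empForm` have moment generating function
at most `exp (K s ^ 2)` near the origin. -/
noncomputable def mgfConst : ℝ :=
  128 * (Real.exp (1 / 4) * ∫ g, Real.exp (g ^ 2 / 4) ∂gaussianReal 0 1)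

lemma mgfConst_pos : 0 < mgfConst := by
  have : 0 < ∫ g, Real.exp (g ^ 2 / 4) ∂gaussianReal 0 1 :=
    integral_exp_pos integrable_exp_sq_gaussianReal
  unfold mgfConst
  positivity

variable {Ω : Type*} [MeasurableSpace Ω] {P : Measure Ω} [IsProbabilityMeasure P]

lemma measureReal_empForm_sub_meanForm_le {h : ℝ → ℝ} (hm : Measurable h)
    (h0 : ∀ t, 0 ≤ h t) (h1 : ∀ t, h t ≤ 1) (hmpos : 0 < m)
    {a : Fin m → Ω → EuclideanSpace ℝ (Fin n)} (hind : iIndepFun a P)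
    (hlaw : ∀ i, HasLaw (a i) (stdGaussian (EuclideanSpace ℝ (Fin n))) P)
    {u z : EuclideanSpace ℝ (Fin n)} (hu : ‖u‖ = 1) (hz : ‖z‖ = 1) {ε : ℝ} (hε : 0 < ε) :
    P.real {ω | ε ≤ |empForm h (fun i => a i ω) u z - meanForm h u z|} ≤
      2 * Real.exp (-(chernoffRate mgfConst ε * m)) := by
  set γ := stdGaussian (EuclideanSpace ℝ (Fin n)) with hγ
  set f : EuclideanSpace ℝ (Fin n) → ℝ :=
    fun b => h (inner ℝ b u) * (inner ℝ b z : ℝ) ^ 2 - meanForm h u z with hf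
  have hmeas : Measurable fun b : EuclideanSpace ℝ (Fin n) =>
      h (inner ℝ b u) * (inner ℝ b z : ℝ) ^ 2 :=
    (hm.comp (by fun_prop)).mul (by fun_prop)
  have hfm : Measurable f := hmeas.sub_const _
  have hbd : ∀ b : EuclideanSpace ℝ (Fin n), 0 ≤ h (inner ℝ b u) * (inner ℝ b z : ℝ) ^ 2 ∧
      h (inner ℝ b u) * (inner ℝ b z : ℝ) ^ 2 ≤ (inner ℝ b z : ℝ) ^ 2 := fun b =>
    ⟨mul_nonneg (h0 _) (sq_nonneg _), mul_le_of_le_one_left (sq_nonneg _) (h1 _)⟩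
  have hint : Integrable (fun b => h (inner ℝ b u) * (inner ℝ b z : ℝ) ^ 2) γ :=
    (memLp_inner_stdGaussian z).integrable_sq.mono' hmeas.aestronglyMeasurable
      (Filter.Eventually.of_forall fun b => by
        rw [Real.norm_eq_abs, abs_of_nonneg (hbd b).1]; exact (hbd b).2)
  have hmean : ∫ b, h (inner ℝ b u) * (inner ℝ b z : ℝ) ^ 2 ∂γ = meanForm h u z :=
    integral_weight_mul_inner_sq hm h0 h1 hu hz
  have hmean0 : 0 ≤ meanForm h u z := hmean ▸ integral_nonneg fun b => (hbd b).1
  have hmean1 : meanForm h u z ≤ 1 := by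
    rw [← hmean]
    calc _ ≤ ∫ b, (inner ℝ b z : ℝ) ^ 2 ∂γ :=
          integral_mono hint (memLp_inner_stdGaussian z).integrable_sq fun b => (hbd b).2
      _ = 1 := by rw [hγ, integral_inner_sq_stdGaussian, hz]; norm_num
  have hf0 : ∫ b, f b ∂γ = 0 := by
    rw [hf, integral_sub hint (integrable_const _), hmean]
    simp
  have hfG : ∀ b, |f b| ≤ (inner ℝ b z : ℝ) ^ 2 + 1 := fun b => by
    rw [abs_le]
    constructor
    · linarith [(hbd b).1, sq_nonneg (inner ℝ b z : ℝ)]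
    · linarith [(hbd b).2]
  have hX : iIndepFun (fun i ω => f (a i ω)) P := hind.comp (fun _ => f) fun _ => hfm
  have hch := measureReal_abs_sum_ge_le hX
    (fun i => hfm.comp_aemeasurable (hlaw i).aemeasurable) mgfConst_pos hε fun i s hs => by
      have hmgf := mgf_le_of_abs_le_sq (hasLaw_inner_stdGaussian hz) hfm hfG hf0 hs
      constructor
      · have := hmgf.1
        rw [← hγ, ← (hlaw i).map_eq] at this
        exact this.comp_aemeasurable (hlaw i).aemeasurable
      · rw [show (∫ ω, Real.exp (s * f (a i ω)) ∂P) = ∫ b, Real.exp (s * f b) ∂γ from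
          (hlaw i).integral_comp (f := fun b => Real.exp (s * f b))
            (by fun_prop)]
        exact hmgf.2
  refine le_trans (measureReal_mono fun ω hω => ?_) hch
  have hm0 : (0 : ℝ) < m := by exact_mod_cast hmpos
  have hsum : ∑ i, f (a i ω) = m * (empForm h (fun i => a i ω) u z - meanForm h u z) := by
    simp only [hf, Finset.sum_sub_distrib, empForm, Finset.sum_const, Finset.card_univ,
      Fintype.card_fin, nsmul_eq_mul]
    field_simp
  simp only [Set.mem_ofPred_eq] at hω ⊢
  rw [hsum, abs_mul, abs_of_pos hm0, mul_comm]
  gcongr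

/-- Uniformly over the sphere, the weighted empirical second moment is close to its mean, up to
a probability controlled by the size of a net. -/
lemma measureReal_exists_empForm_sub_meanForm_le {h : ℝ → ℝ} (hm : Measurable h)
    (h0 : ∀ t, 0 ≤ h t) (h1 : ∀ t, h t ≤ 1) (hmpos : 0 < m)
    {a : Fin m → Ω → EuclideanSpace ℝ (Fin n)} (hind : iIndepFun a P)
    (hlaw : ∀ i, HasLaw (a i) (stdGaussian (EuclideanSpace ℝ (Fin n))) P)
    {u : EuclideanSpace ℝ (Fin n)} (hu : ‖u‖ = 1) {ε : ℝ} (hε : 0 < ε) :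
    P.real {ω | ∃ z, ‖z‖ = 1 ∧ 32 * ε < |empForm h (fun i => a i ω) u z - meanForm h u z|} ≤
      5 ^ n * (2 * Real.exp (-(chernoffRate mgfConst ε * m))) := by
  obtain ⟨s, hcard, hs1, hs⟩ := exists_sphere_net n
  calc _ ≤ P.real (⋃ w ∈ s, {ω | ε ≤ |empForm h (fun i => a i ω) u w - meanForm h u w|}) := by
        refine measureReal_mono (fun ω ⟨z, hz, hzε⟩ => ?_) (measure_ne_top _ _)
        by_contra hcon
        simp only [Set.mem_iUnion, Set.mem_ofPred_eq, not_exists, not_le] at hcon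
        have := abs_apply_le_of_net (B := centredForm h (fun i => a i ω) u) (ε := ε)
          (fun z w => by
            simp only [centredForm_apply, real_inner_comm w z, mul_comm])
          (continuous_centredForm_self _ _ _) hs1 hs
          (fun w hw => by
            rw [centredForm_self _ _ _ (hs1 w hw)]
            exact (hcon w hw).le) hz
        rw [centredForm_self _ _ _ hz] at this
        linarith
    _ ≤ ∑ w ∈ s, P.real {ω | ε ≤ |empForm h (fun i => a i ω) u w - meanForm h u w|} :=
        measureReal_biUnion_finset_le _ _
    _ ≤ ∑ _w ∈ s, 2 * Real.exp (-(chernoffRate mgfConst ε * m)) :=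
        Finset.sum_le_sum fun w hw =>
          measureReal_empForm_sub_meanForm_le hm h0 h1 hmpos hind hlaw hu (hs1 w hw) hε
    _ ≤ _ := by
        rw [Finset.sum_const, nsmul_eq_mul]
        gcongr
        exact_mod_cast hcard

end PhaseRetrieval

namespace PhaseRetrieval

/-! ### The threshold weights and their Gaussian moments -/

/-- The indicator of `g ^ 2 ≤ 1 / 2`, the population version of the set of low magnitudes. -/
noncomputable def lowWeight (g : ℝ) : ℝ := Set.indicator {g : ℝ | g ^ 2 ≤ 1 / 2} 1 g

/-- The indicator of `1 / 2 < g ^ 2`, the population version of the set of high magnitudes. -/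
noncomputable def highWeight (g : ℝ) : ℝ := 1 - lowWeight g

/-- The indicator of `|g ^ 2 - 1 / 2| ≤ η`, where an empirical threshold within `η` of `1 / 2` may
classify `g` differently. -/
noncomputable def bandWeight (η g : ℝ) : ℝ := Set.indicator {g : ℝ | |g ^ 2 - 1 / 2| ≤ η} 1 g

lemma lowWeight_eq (g : ℝ) [Decidable (g ^ 2 ≤ 1 / 2)] :
    lowWeight g = if g ^ 2 ≤ 1 / 2 then 1 else 0 := by
  classical
  simp [lowWeight, Set.indicator_apply]

lemma bandWeight_eq (η g : ℝ) [Decidable (|g ^ 2 - 1 / 2| ≤ η)] :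
    bandWeight η g = if |g ^ 2 - 1 / 2| ≤ η then 1 else 0 := by
  classical
  simp [bandWeight, Set.indicator_apply]

lemma measurableSet_low : MeasurableSet {g : ℝ | g ^ 2 ≤ 1 / 2} :=
  measurableSet_le (by fun_prop) (by fun_prop)

lemma measurableSet_band (η : ℝ) : MeasurableSet {g : ℝ | |g ^ 2 - 1 / 2| ≤ η} :=
  measurableSet_le (by fun_prop) (by fun_prop)

lemma measurable_lowWeight : Measurable lowWeight :=
  measurable_one.indicator measurableSet_low

lemma measurable_highWeight : Measurable highWeight :=
  measurable_const.sub measurable_lowWeight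

lemma measurable_bandWeight (η : ℝ) : Measurable (bandWeight η) :=
  measurable_one.indicator (measurableSet_band η)

lemma lowWeight_nonneg (g : ℝ) : 0 ≤ lowWeight g := by
  classical
  rw [lowWeight_eq]; split_ifs <;> norm_num

lemma lowWeight_le_one (g : ℝ) : lowWeight g ≤ 1 := by
  classical
  rw [lowWeight_eq]; split_ifs <;> norm_num

lemma highWeight_nonneg (g : ℝ) : 0 ≤ highWeight g := sub_nonneg.2 (lowWeight_le_one g)

lemma highWeight_le_one (g : ℝ) : highWeight g ≤ 1 := sub_le_self _ (lowWeight_nonneg g)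

lemma bandWeight_nonneg (η g : ℝ) : 0 ≤ bandWeight η g := by
  classical
  rw [bandWeight_eq]; split_ifs <;> norm_num

lemma bandWeight_le_one (η g : ℝ) : bandWeight η g ≤ 1 := by
  classical
  rw [bandWeight_eq]; split_ifs <;> norm_num

lemma gaussMoment_one : gaussMoment (fun _ => 1) = 1 := by
  simpa [gaussMoment] using integral_sq_gaussianReal

lemma gaussMass_highWeight : gaussMass highWeight = 1 - gaussMass lowWeight := by
  unfold gaussMass highWeight
  rw [integral_sub (integrable_const _)
    (integrable_weight measurable_lowWeight lowWeight_nonneg lowWeight_le_one)]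
  simp

lemma gaussMoment_highWeight : gaussMoment highWeight = 1 - gaussMoment lowWeight := by
  unfold gaussMoment highWeight
  simp_rw [sub_mul, one_mul]
  rw [integral_sub integrable_sq_gaussianReal
    (integrable_weight_mul_sq measurable_lowWeight lowWeight_nonneg lowWeight_le_one),
    integral_sq_gaussianReal]

lemma gaussMass_lowWeight_le_one : gaussMass lowWeight ≤ 1 := by
  have := gaussMass_nonneg highWeight_nonneg
  rw [gaussMass_highWeight] at this
  linarith

lemma gaussMoment_lowWeight_le : gaussMoment lowWeight ≤ gaussMass lowWeight / 2 := by
  unfold gaussMoment gaussMass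
  rw [← integral_div]
  refine integral_mono
    (integrable_weight_mul_sq measurable_lowWeight lowWeight_nonneg lowWeight_le_one)
    ((integrable_weight measurable_lowWeight lowWeight_nonneg lowWeight_le_one).div_const _)
    fun g => ?_
  classical
  simp only [lowWeight_eq]
  split_ifs <;> linarith

lemma gaussMoment_lowWeight_pos : 0 < gaussMoment lowWeight := by
  unfold gaussMoment
  rw [integral_pos_iff_support_of_nonneg
    (fun g => mul_nonneg (lowWeight_nonneg g) (sq_nonneg g))
    (integrable_weight_mul_sq measurable_lowWeight lowWeight_nonneg lowWeight_le_one)]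
  have hsub : Set.Ioo (0 : ℝ) (1 / 2) ⊆ Function.support fun g => lowWeight g * g ^ 2 := by
    intro g hg
    have h1 : g ^ 2 ≤ 1 / 2 := by nlinarith [hg.1, hg.2]
    classical
    simp only [Function.mem_support, lowWeight_eq, if_pos h1, one_mul]
    exact pow_ne_zero _ hg.1.ne'
  refine lt_of_lt_of_le (pos_iff_ne_zero.2 fun h => ?_) (measure_mono hsub)
  have := gaussianReal_absolutelyContinuous' 0 one_ne_zero h
  rw [Real.volume_Ioo] at this
  norm_num at this

/-- The deficit of the low weight's second moment along the signal, compared with the orthogonal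
directions. As the two weights add up to `1` and `E g ^ 2 = 1`, it is also the excess
`gaussMoment highWeight - gaussMass highWeight` of the high weight. -/
noncomputable def spike : ℝ := gaussMass lowWeight - gaussMoment lowWeight

lemma spike_pos : 0 < spike := by
  have h1 := gaussMoment_lowWeight_le
  have h2 := gaussMoment_lowWeight_pos
  unfold spike
  linarith

lemma gaussMoment_bandWeight_le {η : ℝ} (hη : η ≤ 1 / 2) :
    gaussMoment (bandWeight η) ≤ gaussMass (bandWeight η) := by
  refine integral_mono
    (integrable_weight_mul_sq (measurable_bandWeight η) (bandWeight_nonneg η) (bandWeight_le_one η))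
    (integrable_weight (measurable_bandWeight η) (bandWeight_nonneg η) (bandWeight_le_one η))
    fun g => ?_
  classical
  simp only [bandWeight_eq]
  split_ifs with h
  · linarith [(abs_le.1 h).2]
  · simp

/-- The threshold is not an atom of `g ^ 2`, so narrow bands around it have small mass. -/
lemma exists_gaussMass_bandWeight_le {ε : ℝ} (hε : 0 < ε) :
    ∃ η, 0 < η ∧ η ≤ 1 / 2 ∧ gaussMass (bandWeight η) ≤ ε := by
  set s : ℕ → Set ℝ := fun k => {g : ℝ | |g ^ 2 - 1 / 2| ≤ 1 / ((k : ℝ) + 2)} with hs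
  have hanti : Antitone s := fun k l hkl g hg => by
    simp only [hs, Set.mem_ofPred_eq] at hg ⊢
    refine hg.trans ?_
    gcongr
  have hlim := tendsto_measure_iInter_atTop (μ := gaussianReal 0 1) (s := s)
    (fun k => (measurableSet_band (1 / ((k : ℝ) + 2))).nullMeasurableSet) hanti
    ⟨0, measure_ne_top _ _⟩
  have hnull : gaussianReal 0 1 (⋂ k, s k) = 0 := by
    refine gaussianReal_absolutelyContinuous 0 one_ne_zero ?_
    refine measure_mono_null (t := {√(1 / 2), -√(1 / 2)}) (fun g hg => ?_)
      (Set.Finite.measure_zero (by simp) _)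
    have hz : |g ^ 2 - 1 / 2| ≤ 0 := by
      refine le_of_forall_pos_le_add fun e he => ?_
      obtain ⟨k, hk⟩ := exists_nat_one_div_lt he
      have h1 : |g ^ 2 - 1 / 2| ≤ 1 / ((k : ℝ) + 2) := Set.mem_iInter.1 hg k
      have h2 : 1 / ((k : ℝ) + 2) ≤ 1 / ((k : ℝ) + 1) := by gcongr; norm_num
      linarith
    have h2 : g ^ 2 = √(1 / 2) ^ 2 := by
      rw [Real.sq_sqrt (by norm_num)]
      linarith [abs_nonpos_iff.1 hz]
    exact sq_eq_sq_iff_eq_or_eq_neg.1 h2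
  rw [hnull] at hlim
  obtain ⟨k, hk⟩ := (hlim.eventually (gt_mem_nhds (ENNReal.ofReal_pos.2 hε))).exists
  refine ⟨1 / ((k : ℝ) + 2), by positivity, ?_, ?_⟩
  · gcongr
    linarith [(Nat.cast_nonneg k : (0 : ℝ) ≤ k)]
  · have : gaussMass (bandWeight (1 / ((k : ℝ) + 2))) = (gaussianReal 0 1).real (s k) := by
      unfold gaussMass bandWeight
      exact integral_indicator_one (measurableSet_band _)
    rw [this]
    exact ENNReal.toReal_le_of_le_ofReal hε.le hk.le

end PhaseRetrieval

namespace PhaseRetrieval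

/-! ### The deterministic part -/

variable {m n : ℕ}

/-- Concentration of the weighted empirical second moment at accuracy `ε`, on the whole sphere. -/
def Concentrated (h : ℝ → ℝ) (a : Fin m → EuclideanSpace ℝ (Fin n))
    (u : EuclideanSpace ℝ (Fin n)) (ε : ℝ) : Prop :=
  ∀ z, ‖z‖ = 1 → |empForm h a u z - meanForm h u z| ≤ ε

lemma quadForm_outer (v z : EuclideanSpace ℝ (Fin n)) :
    quadForm (outer v) z = (inner ℝ v z : ℝ) ^ 2 := by
  have e : (inner ℝ v z : ℝ) = ∑ j, v j * z j := by
    simp [PiLp.inner_apply, mul_comm]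
  rw [e, pow_two, Finset.sum_mul]
  simp only [quadForm, outer, dotProduct, Matrix.mulVec, Matrix.of_apply]
  refine Finset.sum_congr rfl fun j _ => ?_
  rw [Finset.mul_sum, Finset.mul_sum]
  exact Finset.sum_congr rfl fun k _ => by ring

lemma quadForm_initMatrix (lamNeg lamPos : ℝ) (a : Fin m → EuclideanSpace ℝ (Fin n))
    (ψ : Fin m → ℝ) (z : EuclideanSpace ℝ (Fin n)) :
    quadForm (initMatrix lamNeg lamPos a ψ) z =
      lamNeg / (lowSet ψ).card * ∑ i ∈ lowSet ψ, (inner ℝ (a i) z : ℝ) ^ 2 +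
        lamPos / (highSet ψ).card * ∑ i ∈ highSet ψ, (inner ℝ (a i) z : ℝ) ^ 2 := by
  simp only [← quadForm_outer]
  simp only [quadForm, initMatrix, Matrix.add_mulVec, Matrix.smul_mulVec, Matrix.sum_mulVec,
    dotProduct_add, dotProduct_smul, dotProduct_sum, smul_eq_mul]

lemma meanForm_self (h : ℝ → ℝ) {u : EuclideanSpace ℝ (Fin n)} (hu : ‖u‖ = 1) :
    meanForm h u u = gaussMoment h := by
  simp [meanForm, hu]

lemma inner_sq_le_one {u z : EuclideanSpace ℝ (Fin n)} (hu : ‖u‖ = 1) (hz : ‖z‖ = 1) :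
    (inner ℝ u z : ℝ) ^ 2 ≤ 1 := by
  have := abs_real_inner_le_norm u z
  rw [hu, hz, mul_one] at this
  rw [← sq_abs]
  exact pow_le_one₀ (abs_nonneg _) this

/-- Replacing a weight by the indicator of an index set which agrees with it outside the band
costs at most the second moment of the band. -/
lemma abs_sum_sub_empForm_le {h : ℝ → ℝ} {η : ℝ} {a : Fin m → EuclideanSpace ℝ (Fin n)}
    {u : EuclideanSpace ℝ (Fin n)} (S : Finset (Fin m))
    (hS : ∀ i, |(if i ∈ S then 1 else 0) - h (inner ℝ (a i) u)| ≤ bandWeight η (inner ℝ (a i) u))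
    (z : EuclideanSpace ℝ (Fin n)) :
    |(1 / (m : ℝ)) * ∑ i ∈ S, (inner ℝ (a i) z : ℝ) ^ 2 - empForm h a u z| ≤
      empForm (bandWeight η) a u z := by
  have e : (1 / (m : ℝ)) * ∑ i ∈ S, (inner ℝ (a i) z : ℝ) ^ 2 - empForm h a u z =
      (1 / (m : ℝ)) * ∑ i, ((if i ∈ S then 1 else 0) - h (inner ℝ (a i) u)) *
        (inner ℝ (a i) z : ℝ) ^ 2 := by
    simp [empForm, sub_mul, Finset.sum_sub_distrib, mul_sub]
  rw [e, abs_mul, abs_of_nonneg (by positivity : 0 ≤ 1 / (m : ℝ)), empForm]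
  gcongr
  refine (Finset.abs_sum_le_sum_abs _ _).trans (Finset.sum_le_sum fun i _ => ?_)
  rw [abs_mul, abs_of_nonneg (sq_nonneg (inner ℝ (a i) z : ℝ))]
  gcongr
  exact hS i

/-- The empirical second moment over an index set given by an approximate threshold is close to the
population form of the exact threshold. -/
lemma abs_sum_sub_meanForm_le {h : ℝ → ℝ} {η ε ε' : ℝ} {a : Fin m → EuclideanSpace ℝ (Fin n)}
    {u : EuclideanSpace ℝ (Fin n)} (hu : ‖u‖ = 1) (S : Finset (Fin m))
    (hS : ∀ i, |(if i ∈ S then 1 else 0) - h (inner ℝ (a i) u)| ≤ bandWeight η (inner ℝ (a i) u))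
    (hη : η ≤ 1 / 2) (hband : gaussMass (bandWeight η) ≤ ε) (hεε : ε' ≤ ε)
    (hh : Concentrated h a u ε') (hb : Concentrated (bandWeight η) a u ε')
    {z : EuclideanSpace ℝ (Fin n)} (hz : ‖z‖ = 1) :
    |(1 / (m : ℝ)) * ∑ i ∈ S, (inner ℝ (a i) z : ℝ) ^ 2 - meanForm h u z| ≤ 3 * ε := by
  have h1 := abs_le.1 (abs_sum_sub_empForm_le S hS z)
  have h2 := abs_le.1 (hh z hz)
  have h3 := abs_le.1 (hb z hz)
  have h4 : meanForm (bandWeight η) u z ≤ ε := by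
    have hc := inner_sq_le_one hu hz
    have hc0 := sq_nonneg (inner ℝ u z : ℝ)
    unfold meanForm
    nlinarith [gaussMoment_bandWeight_le hη]
  rw [abs_le]
  constructor <;> linarith [h1.1, h1.2, h2.1, h2.2, h3.2]

lemma signDist_smul_le {d u : EuclideanSpace ℝ (Fin n)} (hd : ‖d‖ = 1) (hu : ‖u‖ = 1)
    {r : ℝ} (hr : 0 ≤ r) (t : ℝ) : signDist ((r * t) • d) (r • u) ≤
      r * (|t - 1| + √(2 * (1 - (inner ℝ u d : ℝ) ^ 2))) := by
  have key : ∀ d : EuclideanSpace ℝ (Fin n), ‖d‖ = 1 → 0 ≤ (inner ℝ u d : ℝ) →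
      ‖(r * t) • d - r • u‖ ≤ r * (|t - 1| + √(2 * (1 - (inner ℝ u d : ℝ) ^ 2))) := by
    intro d hd hc
    have hc1 : (inner ℝ u d : ℝ) ≤ 1 := by
      have := real_inner_le_norm u d
      rwa [hu, hd, mul_one] at this
    have hdu : ‖d - u‖ ≤ √(2 * (1 - (inner ℝ u d : ℝ) ^ 2)) := by
      refine Real.le_sqrt_of_sq_le ?_
      rw [norm_sub_sq_real, hd, hu, real_inner_comm]
      nlinarith
    calc ‖(r * t) • d - r • u‖ = ‖r • ((t - 1) • d + (d - u))‖ := by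
          congr 1; module
      _ ≤ r * (‖(t - 1) • d‖ + ‖d - u‖) := by
          rw [norm_smul, Real.norm_eq_abs, abs_of_nonneg hr]
          gcongr
          exact norm_add_le _ _
      _ ≤ _ := by
          rw [norm_smul, hd, mul_one, Real.norm_eq_abs]
          gcongr
  rcases le_total 0 (inner ℝ u d : ℝ) with hc | hc
  · exact (min_le_right _ _).trans (key d hd hc)
  · refine (min_le_left _ _).trans ?_
    have h := key (-d) (by rwa [norm_neg]) (by rw [inner_neg_right]; linarith)
    rw [inner_neg_right, neg_sq] at h
    rwa [show (r * t) • d + r • u = -((r * t) • (-d) - r • u) by module, norm_neg]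

section Signal

variable {a : Fin m → EuclideanSpace ℝ (Fin n)} {u : EuclideanSpace ℝ (Fin n)} {r : ℝ}

lemma magnitude_smul_sq (i : Fin m) :
    magnitude a (r • u) i ^ 2 = r ^ 2 * (inner ℝ (a i) u : ℝ) ^ 2 := by
  rw [magnitude, sq_abs, real_inner_smul_right, mul_pow]

lemma normEst_magnitude_smul (hr : 0 ≤ r) :
    normEst (magnitude a (r • u)) = r * √(empForm (fun _ => 1) a u u) := by
  rw [normEst]
  simp only [magnitude_smul_sq, ← Finset.mul_sum]
  rw [show 1 / (m : ℝ) * (r ^ 2 * ∑ i, (inner ℝ (a i) u : ℝ) ^ 2) =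
    r ^ 2 * empForm (fun _ => 1) a u u by simp only [empForm, one_mul]; ring,
    Real.sqrt_mul (sq_nonneg r), Real.sqrt_sq hr]

lemma empForm_one_nonneg : 0 ≤ empForm (fun _ => 1) a u u :=
  mul_nonneg (by positivity) (Finset.sum_nonneg fun i _ => by positivity)

lemma mem_lowSet_magnitude (hr : 0 < r) (i : Fin m) : i ∈ lowSet (magnitude a (r • u)) ↔
    (inner ℝ (a i) u : ℝ) ^ 2 ≤ empForm (fun _ => 1) a u u / 2 := by
  simp only [lowSet, Finset.mem_filter, Finset.mem_univ, true_and]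
  rw [magnitude_smul_sq, normEst_magnitude_smul hr.le, mul_pow, Real.sq_sqrt empForm_one_nonneg,
    mul_div_assoc]
  exact mul_le_mul_iff_right₀ (by positivity)

lemma mem_highSet_magnitude (hr : 0 < r) (i : Fin m) : i ∈ highSet (magnitude a (r • u)) ↔
    empForm (fun _ => 1) a u u / 2 ≤ (inner ℝ (a i) u : ℝ) ^ 2 := by
  simp only [highSet, Finset.mem_filter, Finset.mem_univ, true_and]
  rw [magnitude_smul_sq, normEst_magnitude_smul hr.le, mul_pow, Real.sq_sqrt empForm_one_nonneg,
    mul_div_assoc]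
  exact mul_le_mul_iff_right₀ (by positivity)

lemma abs_lowSet_sub_lowWeight_le (hr : 0 < r) {η : ℝ}
    (hρ : |empForm (fun _ => 1) a u u - 1| ≤ 2 * η) (i : Fin m) :
    |(if i ∈ lowSet (magnitude a (r • u)) then 1 else 0) - lowWeight (inner ℝ (a i) u)| ≤
      bandWeight η (inner ℝ (a i) u) := by
  classical
  simp only [mem_lowSet_magnitude hr, lowWeight_eq, bandWeight_eq]
  have h := abs_le.1 hρ
  split_ifs with h1 h2 h3 h3 h2 h3 h3 <;> norm_num <;> refine h3 (abs_le.2 ⟨?_, ?_⟩) <;> linarith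

lemma abs_highSet_sub_highWeight_le (hr : 0 < r) {η : ℝ}
    (hρ : |empForm (fun _ => 1) a u u - 1| ≤ 2 * η) (i : Fin m) :
    |(if i ∈ highSet (magnitude a (r • u)) then 1 else 0) - highWeight (inner ℝ (a i) u)| ≤
      bandWeight η (inner ℝ (a i) u) := by
  classical
  simp only [mem_highSet_magnitude hr, highWeight, lowWeight_eq, bandWeight_eq]
  have h := abs_le.1 hρ
  split_ifs with h1 h2 h3 h3 h2 h3 h3 <;> norm_num <;> refine h3 (abs_le.2 ⟨?_, ?_⟩) <;> linarith

/-- On the event that the four weighted second moments concentrate, the initialization succeeds. Here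
`ε` bounds the mass of the band, and `ε'` is the accuracy of the concentration; both second moments
over the actual index sets are then known up to `3 ε`. The bound on `ε` by `spike` makes the
direction accurate to `δ₀ / 2`, and the bound by `gaussMoment lowWeight` keeps the index sets
non-empty. -/
lemma goodInit_of_concentrated {lamNeg lamPos δ₀ ε ε' η : ℝ} (hneg : lamNeg < 0)
    (hpos : 0 < lamPos) (hδ : 0 < δ₀) (hr : 0 < r) (hu : ‖u‖ = 1)
    (hεspike : 48 * ε ≤ spike * δ₀ ^ 2) (hεlow : 4 * ε ≤ gaussMoment lowWeight)
    (hη : η ≤ 1 / 2) (hband : gaussMass (bandWeight η) ≤ ε)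
    (hε' : 0 < ε') (hε'ε : ε' ≤ ε) (hε'η : ε' ≤ 2 * η) (hε'δ : ε' ≤ δ₀ / 2)
    (hone : Concentrated (fun _ => 1) a u ε') (hlow : Concentrated lowWeight a u ε')
    (hhigh : Concentrated highWeight a u ε') (hb : Concentrated (bandWeight η) a u ε') :
    GoodInit lamNeg lamPos δ₀ a (r • u) := by
  have hρ := hone u hu
  rw [meanForm_self _ hu, gaussMoment_one] at hρ
  set L := lowSet (magnitude a (r • u)) with hL
  set H := highSet (magnitude a (r • u)) with hH
  have hLz := fun z (hz : ‖z‖ = 1) => abs_le.1 (abs_sum_sub_meanForm_le hu L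
    (abs_lowSet_sub_lowWeight_le hr (hρ.trans hε'η)) hη hband hε'ε hlow hb hz)
  have hHz := fun z (hz : ‖z‖ = 1) => abs_le.1 (abs_sum_sub_meanForm_le hu H
    (abs_highSet_sub_highWeight_le hr (hρ.trans hε'η)) hη hband hε'ε hhigh hb hz)
  have hε : 0 < ε := hε'.trans_le hε'ε
  have hq := gaussMoment_lowWeight_le
  have hp := gaussMass_lowWeight_le_one
  have hLu := hLz u hu
  have hHu := hHz u hu
  rw [meanForm_self _ hu] at hLu hHu
  rw [gaussMoment_highWeight] at hHu
  have hLne : L.Nonempty := by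
    by_contra hne
    rw [Finset.not_nonempty_iff_eq_empty.1 hne, Finset.sum_empty, mul_zero] at hLu
    linarith [hLu.1]
  have hHne : H.Nonempty := by
    by_contra hne
    rw [Finset.not_nonempty_iff_eq_empty.1 hne, Finset.sum_empty, mul_zero] at hHu
    linarith [hHu.1]
  refine ⟨hLne, hHne, fun d ⟨hd, hmax⟩ => ?_⟩
  -- otherwise passing from `d` to `u` improves both terms of the objective separately
  have hc : spike * (1 - (inner ℝ u d : ℝ) ^ 2) ≤ 6 * ε := by
    by_contra! hlt
    have hLd := hLz d hd
    have hHd := hHz d hd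
    simp only [meanForm, gaussMoment_highWeight, gaussMass_highWeight] at hLd hHd
    have hm0 : 0 ≤ 1 / (m : ℝ) := by positivity
    rw [spike] at hlt
    have hLlt : ∑ i ∈ L, (inner ℝ (a i) u : ℝ) ^ 2 < ∑ i ∈ L, (inner ℝ (a i) d : ℝ) ^ 2 := by
      refine lt_of_mul_lt_mul_left ?_ hm0
      nlinarith [hLd.1, hLu.2]
    have hHlt : ∑ i ∈ H, (inner ℝ (a i) d : ℝ) ^ 2 < ∑ i ∈ H, (inner ℝ (a i) u : ℝ) ^ 2 := by
      refine lt_of_mul_lt_mul_left ?_ hm0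
      nlinarith [hHd.2, hHu.1]
    have hu' := hmax u hu
    rw [quadForm_initMatrix, quadForm_initMatrix, ← hL, ← hH] at hu'
    have h1 := mul_lt_mul_of_neg_left hLlt
      (div_neg_of_neg_of_pos hneg (by exact_mod_cast hLne.card_pos : (0 : ℝ) < L.card))
    have h2 := mul_lt_mul_of_pos_left hHlt
      (div_pos hpos (by exact_mod_cast hHne.card_pos : (0 : ℝ) < H.card))
    linarith
  rw [normEst_magnitude_smul hr.le, norm_smul, hu, mul_one, Real.norm_eq_abs, abs_of_pos hr,
    mul_comm δ₀]
  refine (signDist_smul_le hd hu hr.le _).trans ?_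
  gcongr
  have h1 : |√(empForm (fun _ => 1) a u u) - 1| ≤ δ₀ / 2 := by
    have hs := Real.sqrt_nonneg (empForm (fun _ => 1) a u u)
    have e : empForm (fun _ => 1) a u u - 1 =
        (√(empForm (fun _ => 1) a u u) - 1) * (√(empForm (fun _ => 1) a u u) + 1) := by
      nlinarith [Real.sq_sqrt (empForm_one_nonneg (a := a) (u := u))]
    rw [e, abs_mul, abs_of_nonneg (by linarith : 0 ≤ √(empForm (fun _ => 1) a u u) + 1)] at hρ
    nlinarith [abs_nonneg (√(empForm (fun _ => 1) a u u) - 1)]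
  have h2 : √(2 * (1 - (inner ℝ u d : ℝ) ^ 2)) ≤ δ₀ / 2 := by
    refine Real.sqrt_le_iff.2 ⟨by positivity, ?_⟩
    have : spike * (2 * (1 - (inner ℝ u d : ℝ) ^ 2)) ≤ spike * (δ₀ / 2) ^ 2 := by nlinarith
    exact le_of_mul_le_mul_left this spike_pos
  linarith

end Signal

/-- For the zero signal all magnitudes vanish, so both index sets are full and `z₀ = 0`. -/
lemma goodInit_zero {lamNeg lamPos δ₀ : ℝ} (hm : 0 < m) (a : Fin m → EuclideanSpace ℝ (Fin n)) :
    GoodInit lamNeg lamPos δ₀ a 0 := by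
  have hψ : magnitude a 0 = fun _ => 0 := by ext i; simp [magnitude]
  have h0 : normEst (fun _ : Fin m => (0 : ℝ)) = 0 := by simp [normEst]
  rw [GoodInit, hψ, h0]
  exact ⟨⟨⟨0, hm⟩, by simp [lowSet, h0]⟩, ⟨⟨0, hm⟩, by simp [highSet, h0]⟩, fun d _ => by
    simp [signDist]⟩

end PhaseRetrieval

namespace PhaseRetrieval

/-! ### The probabilistic conclusion -/

variable {m n : ℕ} {Ω : Type*} [MeasurableSpace Ω] {P : Measure Ω} [IsProbabilityMeasure P]

/-- An outer-measure bound on the exceptional set yields a measurable event of complementary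
probability; the samples are only almost everywhere measurable, so the exceptional set itself need
not be measurable. -/
lemma exists_measurableSet_of_measureReal_not_le {p : Ω → Prop} {b : ℝ}
    (h : P.real {ω | ¬ p ω} ≤ b) :
    ∃ E, MeasurableSet E ∧ (∀ ω ∈ E, p ω) ∧ 1 - b ≤ P.real E := by
  refine ⟨(toMeasurable P {ω | ¬ p ω})ᶜ, (measurableSet_toMeasurable _ _).compl,
    fun ω hω => ?_, ?_⟩
  · by_contra hp
    exact hω (subset_toMeasurable _ _ hp)
  · rw [probReal_compl_eq_one_sub (measurableSet_toMeasurable _ _)]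
    have : P.real (toMeasurable P {ω | ¬ p ω}) = P.real {ω | ¬ p ω} := by
      rw [measureReal_def, measure_toMeasurable, measureReal_def]
    linarith

lemma measureReal_not_concentrated_le {h : ℝ → ℝ} (hm : Measurable h)
    (h0 : ∀ t, 0 ≤ h t) (h1 : ∀ t, h t ≤ 1) (hmpos : 0 < m)
    {a : Fin m → Ω → EuclideanSpace ℝ (Fin n)} (hind : iIndepFun a P)
    (hlaw : ∀ i, HasLaw (a i) (stdGaussian (EuclideanSpace ℝ (Fin n))) P)
    {u : EuclideanSpace ℝ (Fin n)} (hu : ‖u‖ = 1) {ε : ℝ} (hε : 0 < ε) :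
    P.real {ω | ¬ Concentrated h (fun i => a i ω) u ε} ≤
      5 ^ n * (2 * Real.exp (-(chernoffRate mgfConst (ε / 32) * m))) := by
  refine le_trans (measureReal_mono fun ω hω => ?_)
    (measureReal_exists_empForm_sub_meanForm_le hm h0 h1 hmpos hind hlaw hu
      (ε := ε / 32) (by positivity))
  simp only [Concentrated, Set.mem_ofPred_eq] at hω ⊢
  push Not at hω
  obtain ⟨z, hz, hlt⟩ := hω
  exact ⟨z, hz, by linarith⟩

lemma five_pow_mul_exp_le {κ : ℝ} (hκ : 0 < κ) (h : 2 * Real.log 5 / κ * n ≤ m) :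
    5 ^ n * Real.exp (-(κ * m)) ≤ Real.exp (-(κ / 2 * m)) := by
  have h5 : (5 : ℝ) ^ n = Real.exp (n * Real.log 5) := by
    rw [Real.exp_nat_mul, Real.exp_log (by norm_num)]
  rw [h5, ← Real.exp_add]
  gcongr
  have : κ * (2 * Real.log 5 / κ * n) ≤ κ * m := by gcongr
  rw [show κ * (2 * Real.log 5 / κ * n) = 2 * (n * Real.log 5) by field_simp] at this
  linarith

end PhaseRetrieval

open PhaseRetrieval in
theorem theorem1 :
    ∀ δ₀ : ℝ, 0 < δ₀ → δ₀ < 1 →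
      ∃ c₀ C₀ : ℝ, 0 < c₀ ∧
        ∀ lamNeg lamPos : ℝ, lamNeg < 0 → 0 < lamPos →
        ∀ m n : ℕ, C₀ * (n : ℝ) ≤ (m : ℝ) →
        ∀ x : EuclideanSpace ℝ (Fin n),
        ∀ (Ω : Type*) [MeasurableSpace Ω] (P : Measure Ω) [IsProbabilityMeasure P]
          (a : Fin m → Ω → EuclideanSpace ℝ (Fin n)),
          iIndepFun a P →
          (∀ i, HasLaw (a i) (stdGaussian (EuclideanSpace ℝ (Fin n))) P) →
          ∃ E : Set Ω, MeasurableSet E ∧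
            (∀ ω ∈ E, PhaseRetrieval.GoodInit lamNeg lamPos δ₀ (fun i => a i ω) x) ∧
            1 - 10 * Real.exp (-(c₀ * (m : ℝ))) ≤ P.real E := by
  intro δ₀ hδ _
  obtain ⟨ε, hε, hε1, hε2⟩ : ∃ ε : ℝ, 0 < ε ∧ 48 * ε ≤ spike * δ₀ ^ 2 ∧
      4 * ε ≤ gaussMoment lowWeight := by
    have h1 := spike_pos
    have h2 := gaussMoment_lowWeight_pos
    refine ⟨min (spike * δ₀ ^ 2 / 48) (gaussMoment lowWeight / 4), by positivity, ?_, ?_⟩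
    · linarith [min_le_left (spike * δ₀ ^ 2 / 48) (gaussMoment lowWeight / 4)]
    · linarith [min_le_right (spike * δ₀ ^ 2 / 48) (gaussMoment lowWeight / 4)]
  obtain ⟨η, hη0, hη, hband⟩ := exists_gaussMass_bandWeight_le hε
  set ε' := min ε (min (2 * η) (δ₀ / 2)) with hε'def
  have hε' : 0 < ε' := by positivity
  set κ := chernoffRate mgfConst (ε' / 32) with hκdef
  have hκ : 0 < κ := chernoffRate_pos mgfConst_pos (by positivity)
  -- half of the exponent `κ m` pays for the `5 ^ n` points of the net
  refine ⟨κ / 2, 2 * Real.log 5 / κ, by positivity, ?_⟩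
  intro lamNeg lamPos hneg hpos m n hmn x Ω _ P _ a hind hlaw
  apply exists_measurableSet_of_measureReal_not_le
  have hexp : 0 < Real.exp (-(κ / 2 * m)) := Real.exp_pos _
  rcases Nat.eq_zero_or_pos m with rfl | hm
  · -- without samples the claimed bound exceeds one
    refine measureReal_le_one.trans ?_
    norm_num
  rcases eq_or_ne x 0 with rfl | hx
  · simp only [goodInit_zero hm, not_true_eq_false, Set.ofPred_false, measureReal_empty]
    positivity
  set u := ‖x‖⁻¹ • x with hudef
  have hx0 : 0 < ‖x‖ := norm_pos_iff.2 hx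
  have hu : ‖u‖ = 1 := by rw [hudef, norm_smul, norm_inv, norm_norm, inv_mul_cancel₀ hx0.ne']
  have hxu : x = ‖x‖ • u := by rw [hudef, smul_inv_smul₀ hx0.ne']
  have hP := fun (h : ℝ → ℝ) (hmeas : Measurable h) (h0 : ∀ t, 0 ≤ h t) (h1 : ∀ t, h t ≤ 1) =>
    measureReal_not_concentrated_le hmeas h0 h1 hm hind hlaw hu hε'
  have h1 := hP (fun _ => 1) measurable_const (fun _ => zero_le_one) fun _ => le_rfl
  have h2 := hP _ measurable_lowWeight lowWeight_nonneg lowWeight_le_one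
  have h3 := hP _ measurable_highWeight highWeight_nonneg highWeight_le_one
  have h4 := hP _ (measurable_bandWeight η) (bandWeight_nonneg η) (bandWeight_le_one η)
  have hsub : {ω | ¬ GoodInit lamNeg lamPos δ₀ (fun i => a i ω) x} ⊆
      ({ω | ¬ Concentrated (fun _ => 1) (fun i => a i ω) u ε'} ∪
        {ω | ¬ Concentrated lowWeight (fun i => a i ω) u ε'}) ∪
      ({ω | ¬ Concentrated highWeight (fun i => a i ω) u ε'} ∪
        {ω | ¬ Concentrated (bandWeight η) (fun i => a i ω) u ε'}) := by
    intro ω hω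
    by_contra hcon
    simp only [Set.mem_union, Set.mem_ofPred_eq, not_or, not_not] at hcon hω
    obtain ⟨⟨c1, c2⟩, c3, c4⟩ := hcon
    rw [hxu] at hω
    exact hω (goodInit_of_concentrated hneg hpos hδ hx0 hu hε1 hε2 hη hband hε'
      (min_le_left _ _) ((min_le_right _ _).trans (min_le_left _ _))
      ((min_le_right _ _).trans (min_le_right _ _)) c1 c2 c3 c4)
  have hfive := five_pow_mul_exp_le hκ hmn
  refine (measureReal_mono hsub (measure_ne_top _ _)).trans ((measureReal_union_le _ _).trans ?_)
  refine (add_le_add (measureReal_union_le _ _) (measureReal_union_le _ _)).trans ?_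
  rw [← hκdef] at h1 h2 h3 h4
  linarith
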